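/- Let $a<0$ be a square-free integer and $b$ a prime number whose Legendre symbols satisfy $\left(\frac{a}{b}\right)=-1$, $\left(\frac{-1}{b}\right)=1$, $\left(\frac{-3}{b}\right)=1$. Let $\mathfrak A=\left(\frac{a,b}{\mathbb Q}\right)$ be the quaternion algebra over $\mathbb Q$ with basis $1,\omega,\Omega,\omega\Omega$, where $\omega^2=a$, $\Omega^2=b$, $\omega\Omega+\Omega\omega=0$, assumed to be a division algebra. Write its elements as $\alpha=\xi+\eta\,\Omega$ with $\xi,\eta\in\mathbb Q(\omega)\simeq\mathbb Q(\sqrt a)\subset\mathbb C$, and put $\overline\alpha=\overline\xi-\eta\,\Omega$, $\mathrm N(\alpha)=\alpha\overline\alpha$, $\mathrm{Tr}(\alpha)=\alpha+\overline\alpha$. Let $\mathfrak I$ be an order of $\mathfrak A$, i.e. a subring (with $1$) whose elements have integral norm and trace and which is generated as an abelian group by four elements linearly independent over $\mathbb Q$. Let $$\Gamma_R=\left\{\begin{pmatrix}\xi&\eta\\ b\overline\eta&\overline\xi\end{pmatrix}\;:\;\xi+\eta\,\Omega\in\mathfrak I,\ \mathrm N(\xi+\eta\,\Omega)=1\right\}\subset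 \mathrm{SL}(2,\mathbb C),$$ acting on $\mathbb H^3=\{(z,t):z\in\mathbb C,\ t>0\}$ by Poincaré extension, and suppose that $\Gamma_R/\{\pm1\}$ acts freely on $\mathbb H^3$. Let $X_R=\Gamma_R\backslash\mathbb H^3$, with projection $\pi_R:\mathbb H^3\to X_R$ (a $(K_2^S)$-manifold). The imbedded totally geodesic surfaces (itgs) of $\mathbb H^3$ are the half-spheres $S(c,r)=\{(z,t)\in\mathbb H^3:|z-c|^2+t^2=r^2\}$ ($c\in\mathbb C$, $r>0$) and the half-planes $D\times\,]0,\infty[$ over the real affine lines $D\subset\mathbb C$. An itgs $S$ is called closed for $\Gamma_R$ if its projection $\pi_R(S)$ in $X_R$ is compact. Then the half-sphere $S^{o}=S(0,1/\sqrt b)$ is an itgs with $\gamma\cdot S^{o}=S^{o}$ for all $\gamma\in\Gamma_R$, its projection in $X_R$ is compact, and no other itgs of $\mathbb H^3$ is closed for $\Gamma_R$. -/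

import Mathlib

open scoped Quaternion MatrixGroups

/-! ### Hyperbolic three-space and the Poincaré extension -/

/-- The upper half-space `{(z, t) : z ∈ ℂ, t > 0}`, with the topology induced by `ℂ × ℝ`
(which is also the topology of the hyperbolic metric). -/
abbrev HypSpace : Type := {x : ℂ × ℝ // 0 < x.2}

namespace HypSpace

/-- The denominator `|c z + d|² + |c|² t²` of the Poincaré extension. -/
noncomputable def den (γ : SL(2, ℂ)) (x : HypSpace) : ℝ :=
  Complex.normSq (γ 1 0 * x.1.1 + γ 1 1) + Complex.normSq (γ 1 0) * x.1.2 ^ 2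

theorem den_pos (γ : SL(2, ℂ)) (x : HypSpace) : 0 < den γ x := by
  have ht := x.2
  unfold den
  by_cases hc : γ 1 0 = 0
  · have hd : γ 1 1 ≠ 0 := by
      intro hd
      have := Matrix.det_fin_two (γ : Matrix (Fin 2) (Fin 2) ℂ)
      rw [γ.det_coe, hc, hd] at this
      simp at this
    have := Complex.normSq_pos.2 hd
    simpa [hc] using this
  · have := Complex.normSq_pos.2 hc
    have h2 := Complex.normSq_nonneg (γ 1 0 * x.1.1 + γ 1 1)
    positivity

/-- The Poincaré extension of a matrix `(a, b; c, d)` of determinant one. Inside Hamilton's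
quaternions, with `x = z + t j`, this is `(a x + b) (c x + d)⁻¹`. -/
noncomputable def act (γ : SL(2, ℂ)) (x : HypSpace) : HypSpace :=
  ⟨(((γ 0 0 * x.1.1 + γ 0 1) * (starRingEnd ℂ) (γ 1 0 * x.1.1 + γ 1 1)
        + γ 0 0 * (starRingEnd ℂ) (γ 1 0) * (x.1.2 : ℂ) ^ 2) / (den γ x : ℂ),
      x.1.2 / den γ x),
    div_pos x.2 (den_pos γ x)⟩

theorem act_fst (γ : SL(2, ℂ)) (x : HypSpace) : (act γ x).1.1 =
    ((γ 0 0 * x.1.1 + γ 0 1) * (starRingEnd ℂ) (γ 1 0 * x.1.1 + γ 1 1)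
        + γ 0 0 * (starRingEnd ℂ) (γ 1 0) * (x.1.2 : ℂ) ^ 2) / (den γ x : ℂ) := rfl

theorem act_snd (γ : SL(2, ℂ)) (x : HypSpace) : (act γ x).1.2 = x.1.2 / den γ x := rfl

theorem den_mul (g h : SL(2, ℂ)) (x : HypSpace) :
    den (g * h) x = den g (act h x) * den h x := by
  have hD := den_pos h x
  have hD' : ((den h x : ℝ) : ℂ) ≠ 0 := by exact_mod_cast hD.ne'
  have hdet : h 0 0 * h 1 1 - h 0 1 * h 1 0 = 1 := by
    rw [← Matrix.det_fin_two, h.det_coe]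
  have hdet' := congrArg (starRingEnd ℂ) hdet
  have hden : ((den h x : ℝ) : ℂ) =
      (h 1 0 * x.1.1 + h 1 1) * (starRingEnd ℂ) (h 1 0 * x.1.1 + h 1 1)
        + h 1 0 * (starRingEnd ℂ) (h 1 0) * (x.1.2 : ℂ) ^ 2 := by
    rw [Complex.mul_conj, Complex.mul_conj]
    simp [den]
  apply Complex.ofReal_injective
  rw [Complex.ofReal_mul]
  conv_lhs => simp only [den]
  conv_rhs => enter [1]; simp only [den]
  simp only [act, Complex.ofReal_add, Complex.ofReal_mul, ← Complex.mul_conj,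
    Complex.ofReal_pow, Complex.ofReal_div, map_add, map_mul, map_div₀, Complex.conj_ofReal,
    map_pow, Matrix.SpecialLinearGroup.coe_mul, Matrix.mul_apply, Fin.sum_univ_two,
    Complex.conj_conj]
  simp only [map_sub, map_mul, map_one] at hdet'
  field_simp
  rw [hden]
  simp only [map_add, map_mul]
  generalize (starRingEnd ℂ) (h 0 0) = a' at *
  generalize (starRingEnd ℂ) (h 0 1) = b' at *
  generalize (starRingEnd ℂ) (h 1 0) = c' at *
  generalize (starRingEnd ℂ) (h 1 1) = d' at *
  generalize (starRingEnd ℂ) (g 1 0) = r' at *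
  generalize (starRingEnd ℂ) (g 1 1) = s' at *
  generalize (starRingEnd ℂ) x.1.1 = z' at *
  generalize h 0 0 = a at *
  generalize h 0 1 = b at *
  generalize h 1 0 = c at *
  generalize h 1 1 = d at *
  generalize g 1 0 = r at *
  generalize g 1 1 = s at *
  generalize x.1.1 = z at *
  generalize (x.1.2 : ℂ) = t at *
  linear_combination (r * r' * t ^ 2) * (a' * d' - b' * c') * hdet + (r * r' * t ^ 2) * hdet'

/-- `SL(2, ℂ)` acts on hyperbolic space by Poincaré extensions. -/
noncomputable instance : MulAction SL(2, ℂ) HypSpace where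
  smul := act
  one_smul x := by
    change act 1 x = x
    apply Subtype.ext
    apply Prod.ext <;> simp [act, den]
  mul_smul g h x := by
    change act (g * h) x = act g (act h x)
    have hD := den_pos h x
    have hD' : ((den h x : ℝ) : ℂ) ≠ 0 := by exact_mod_cast hD.ne'
    have hE := den_pos g (act h x)
    have hE' : ((den g (act h x) : ℝ) : ℂ) ≠ 0 := by exact_mod_cast hE.ne'
    have hmul := den_mul g h x
    have hdet : h 0 0 * h 1 1 - h 0 1 * h 1 0 = 1 := by
      rw [← Matrix.det_fin_two, h.det_coe]
    have hdet' := congrArg (starRingEnd ℂ) hdet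
    have hden : ((den h x : ℝ) : ℂ) =
        (h 1 0 * x.1.1 + h 1 1) * (starRingEnd ℂ) (h 1 0 * x.1.1 + h 1 1)
          + h 1 0 * (starRingEnd ℂ) (h 1 0) * (x.1.2 : ℂ) ^ 2 := by
      rw [Complex.mul_conj, Complex.mul_conj]
      simp [den]
    apply Subtype.ext
    apply Prod.ext
    · rw [act_fst (g * h) x, act_fst g (act h x), hmul, Complex.ofReal_mul]
      generalize ((den g (act h x) : ℝ) : ℂ) = E at *
      rw [div_eq_div_iff (mul_ne_zero hE' hD') hE']
      simp only [act_fst, act_snd, Complex.ofReal_div, map_add, map_mul, map_div₀, Complex.conj_ofReal,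
        map_pow, Matrix.SpecialLinearGroup.coe_mul, Matrix.mul_apply, Fin.sum_univ_two,
        Complex.conj_conj]
      simp only [map_sub, map_mul, map_one] at hdet'
      field_simp
      rw [hden]
      simp only [map_add, map_mul]
      generalize (starRingEnd ℂ) (h 0 0) = a' at *
      generalize (starRingEnd ℂ) (h 0 1) = b' at *
      generalize (starRingEnd ℂ) (h 1 0) = c' at *
      generalize (starRingEnd ℂ) (h 1 1) = d' at *
      generalize (starRingEnd ℂ) (g 1 0) = r' at *
      generalize (starRingEnd ℂ) (g 1 1) = s' at *
      generalize (starRingEnd ℂ) x.1.1 = z' at *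
      generalize h 0 0 = a at *
      generalize h 0 1 = b at *
      generalize h 1 0 = c at *
      generalize h 1 1 = d at *
      generalize g 0 0 = p at *
      generalize g 0 1 = q at *
      generalize g 1 0 = r at *
      generalize g 1 1 = s at *
      generalize x.1.1 = z at *
      generalize (x.1.2 : ℂ) = t at *
      linear_combination (p * r' * t ^ 2) * (a' * d' - b' * c') * hdet
        + (p * r' * t ^ 2) * hdet'
    · rw [act_snd, act_snd, act_snd, hmul, div_div, mul_comm (den h x)]

end HypSpace

namespace HypSpace

/-- The half-sphere `S(a, r)` centred at `a ∈ ℂ`, of radius `r`. -/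
def halfSphere (a : ℂ) (r : ℝ) : Set HypSpace :=
  {x | Complex.normSq (x.1.1 - a) + x.1.2 ^ 2 = r ^ 2}

/-- The half-plane orthogonal to `ℂ` over the line through `p` with direction `v`. -/
def halfPlane (p v : ℂ) : Set HypSpace :=
  {x | ∃ s : ℝ, x.1.1 = p + s * v}

/-- The imbedded totally geodesic surfaces (itgs) of hyperbolic space: the half-spheres centred
on `ℂ` and the half-planes orthogonal to `ℂ`. -/
def IsItgs (S : Set HypSpace) : Prop :=
  (∃ (a : ℂ) (r : ℝ), 0 < r ∧ S = halfSphere a r) ∨ ∃ p v : ℂ, v ≠ 0 ∧ S = halfPlane p v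

end HypSpace

/-! ### Quaternion algebras, orders and the associated groups -/

/-- The rational quaternion algebra of type `(a, b)`: it has the basis `1, ω, Ω, ωΩ` with
`ω² = a`, `Ω² = b`, `ωΩ + Ωω = 0` (Mathlib's `1, i, j, k`). Conjugation is `star`. -/
abbrev QuatAlg (a : ℤ) (b : ℕ) : Type := ℍ[ℚ,(a : ℚ),(b : ℚ)]

namespace QuatAlg

variable {a : ℤ} {b : ℕ}

/-- The reduced norm `N(α) = α ᾱ`, a rational number. -/
def nrd (α : QuatAlg a b) : ℚ := (α * star α).re

/-- The reduced trace `Tr(α) = α + ᾱ`, a rational number. -/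
def trd (α : QuatAlg a b) : ℚ := (α + star α).re

theorem nrd_eq (α : QuatAlg a b) :
    nrd α = α.re ^ 2 - a * α.imI ^ 2 - b * (α.imJ ^ 2 - a * α.imK ^ 2) := by
  simp [nrd]
  ring

theorem nrd_spec (α : QuatAlg a b) : α * star α = algebraMap ℚ (QuatAlg a b) (nrd α) := by
  ext <;> simp [nrd] <;> ring

theorem trd_spec (α : QuatAlg a b) : α + star α = algebraMap ℚ (QuatAlg a b) (trd α) := by
  ext <;> simp [trd]

theorem nrd_mul (α β : QuatAlg a b) : nrd (α * β) = nrd α * nrd β := by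
  simp only [nrd_eq]
  simp
  ring

theorem nrd_star (α : QuatAlg a b) : nrd (star α) = nrd α := by
  simp [nrd_eq]

/-- The complex square root `√a` (it is `i √|a|` when `a < 0`). -/
noncomputable def root (a : ℤ) : ℂ := (a : ℂ) ^ (1 / 2 : ℂ)

theorem root_mul_root (a : ℤ) : root a * root a = a := by
  have h := Complex.cpow_nat_inv_pow (a : ℂ) (n := 2) two_ne_zero
  rw [pow_two] at h
  simpa [root] using h

/-- The representation `ξ + η Ω ↦ (ξ, η; b η', ξ')`, where `ξ = x₀ + x₁ √a`, `η = x₂ + x₃ √a`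
and `'` is the conjugation of `ℚ(√a)` (complex conjugation when `a < 0`). -/
noncomputable def rep (a : ℤ) (b : ℕ) : QuatAlg a b →+* Matrix (Fin 2) (Fin 2) ℂ where
  toFun α := !![(α.re : ℂ) + α.imI * root a, (α.imJ : ℂ) + α.imK * root a;
    b * ((α.imJ : ℂ) - α.imK * root a), (α.re : ℂ) - α.imI * root a]
  map_one' := by
    ext i j
    fin_cases i <;> fin_cases j <;> simp
  map_zero' := by
    ext i j
    fin_cases i <;> fin_cases j <;> simp
  map_add' α β := by
    ext i j
    fin_cases i <;> fin_cases j <;> simp <;> ring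
  map_mul' α β := by
    have h := root_mul_root a
    ext i j
    fin_cases i <;> fin_cases j <;> simp [Matrix.mul_apply] <;> grind

theorem det_rep (α : QuatAlg a b) : (rep a b α).det = (nrd α : ℂ) := by
  have h := root_mul_root a
  rw [Matrix.det_fin_two, nrd_eq]
  simp [rep]
  linear_combination (-(α.imI : ℂ) ^ 2 + b * (α.imK : ℂ) ^ 2) * h

end QuatAlg

/-- An order in the rational quaternion algebra of type `(a, b)`: a subring all of whose elements
have integral norm and trace, and which is generated as an abelian group by four elements that are
linearly independent over `ℚ`. -/
structure QuatOrder (a : ℤ) (b : ℕ) where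
  toSubring : Subring (QuatAlg a b)
  nrd_int : ∀ α ∈ toSubring, ∃ n : ℤ, QuatAlg.nrd α = n
  trd_int : ∀ α ∈ toSubring, ∃ n : ℤ, QuatAlg.trd α = n
  exists_generators : ∃ e : Fin 4 → QuatAlg a b, LinearIndependent ℚ e ∧
    AddSubgroup.closure (Set.range e) = toSubring.toAddSubgroup

namespace QuatOrder

open HypSpace

variable {a : ℤ} {b : ℕ} (O : QuatOrder a b)

theorem star_mem {α : QuatAlg a b} (h : α ∈ O.toSubring) : star α ∈ O.toSubring := by
  obtain ⟨n, hn⟩ := O.trd_int α h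
  have h1 := QuatAlg.trd_spec α
  rw [hn] at h1
  have h2 : star α = (n : QuatAlg a b) - α := by
    rw [eq_sub_iff_add_eq', h1]
    simp
  rw [h2]
  exact sub_mem (intCast_mem _ n) h

/-- The group `Γ` of the images in `SL(2, ℂ)` of the elements of norm one of the order. -/
noncomputable def Γ : Subgroup SL(2, ℂ) where
  carrier := {γ | ∃ α ∈ O.toSubring, QuatAlg.nrd α = 1 ∧
    (γ : Matrix (Fin 2) (Fin 2) ℂ) = QuatAlg.rep a b α}
  one_mem' := ⟨1, one_mem _, by simp [QuatAlg.nrd], by simp⟩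
  mul_mem' := by
    rintro g h ⟨α, hα, nα, eα⟩ ⟨β, hβ, nβ, eβ⟩
    exact ⟨α * β, mul_mem hα hβ, by rw [QuatAlg.nrd_mul, nα, nβ, one_mul], by
      rw [map_mul, Matrix.SpecialLinearGroup.coe_mul, eα, eβ]⟩
  inv_mem' := by
    rintro g ⟨α, hα, nα, eα⟩
    refine ⟨star α, O.star_mem hα, by rw [QuatAlg.nrd_star, nα], ?_⟩
    have h1 : QuatAlg.rep a b α * QuatAlg.rep a b (star α) = 1 := by
      rw [← map_mul, QuatAlg.nrd_spec, nα, map_one, map_one]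
    have h2 : (g : Matrix (Fin 2) (Fin 2) ℂ) * (g⁻¹ : SL(2, ℂ)) = 1 := by
      rw [← Matrix.SpecialLinearGroup.coe_mul, mul_inv_cancel, Matrix.SpecialLinearGroup.coe_one]
    rw [← eα] at h1
    have h3 : ((g⁻¹ : SL(2, ℂ)) : Matrix (Fin 2) (Fin 2) ℂ) * g = 1 := by
      rw [← Matrix.SpecialLinearGroup.coe_mul, inv_mul_cancel, Matrix.SpecialLinearGroup.coe_one]
    exact left_inv_eq_right_inv h3 h1

/-- The quotient space `X = Γ \ ℍ³`, with the quotient topology. -/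
abbrev X : Type := Quotient (MulAction.orbitRel O.Γ HypSpace)

/-- The canonical projection `π : ℍ³ → X`. -/
noncomputable def π (x : HypSpace) : O.X := Quotient.mk _ x

/-- A subset of `ℍ³` (in practice an itgs) is closed for `Γ` if its projection in `X` is
compact. -/
def IsClosedFor (S : Set HypSpace) : Prop := IsCompact (O.π '' S)

/-- The conditions that make `X` a `(K₂)`-manifold: `a < 0` and `b > 0` are square-free, the
quaternion algebra is a division algebra, and `Γ` acts freely on `ℍ³` (up to `±1`, which acts
trivially). -/
structure IsK2 : Prop where
  a_neg : a < 0
  b_pos : 0 < b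
  a_squarefree : Squarefree a
  b_squarefree : Squarefree b
  division : ∀ α : QuatAlg a b, α ≠ 0 → IsUnit α
  free : ∀ γ ∈ O.Γ, ∀ x : HypSpace, γ • x = x → γ = 1 ∨ γ = -1

/-- The conditions that make `X` a `(K₂^S)`-manifold: moreover `b` is prime and the Legendre
symbols of `a`, `-1`, `-3` modulo `b` are `-1`, `1`, `1`. -/
structure IsK2S [Fact b.Prime] : Prop extends IsK2 O where
  legendre_a : legendreSym b a = -1
  legendre_neg_one : legendreSym b (-1) = 1
  legendre_neg_three : legendreSym b (-3) = 1

end QuatOrder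

/-!
Write `S⁰` for the half-sphere `S(0, 1/√b)`. An element `α = ξ + η Ω` acts as a similitude of factor
`nrd α` on the Hermitian form of signature `(1, 1)` whose isotropic lines form the circle
`|z| = 1/√b` (`QuatAlg.rowForm_sub`). Hence the function `height b = (b (|z|² + t²) - 1) / t`, which
vanishes exactly on `S⁰`, is invariant under `Γ` (`QuatOrder.height_smul`), and `Γ` preserves `S⁰`.

*No other itgs is closed.* The function `height b` descends to a continuous function on `X`, so it
is bounded on any itgs with compact projection. Its absolute value tends to infinity at every
boundary point `z` of `ℂ` off the circle `|z| = 1/√b`, and the only itgs with boundary in this circle is `S⁰`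
(`HypSpace.IsItgs.eq_halfSphere_of_height_bounded`).

*`S⁰` is closed.* It is enough to move every point `x` of `S⁰` by `Γ` to a height bounded from below
(`QuatOrder.exists_le_snd_smul`). The height of `γ • x` is `t` divided by the value `rowForm 1` at
the second row of `γ`. Dirichlet's approximation theorem gives a nonzero `α` in the order at which
this value is at most `C t` (`QuatOrder.exists_mem_rowForm_le`). On `S⁰` the value bounds
`|nrd α| t`, so the integer `n = nrd α` belongs to a finite set, and `n ≠ 0` since the algebra is a
division algebra. There are finitely many classes modulo `n` in the order, and if `β` of norm `n` is
congruent to `α` modulo `n`, then `β̄ α / n` has norm one and lies in the order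
(`QuatOrder.exists_unit_of_congr`). For `β` in a finite set of representatives this unit has value
at most `C' t` at its second row, with `C'` independent of `x`.
-/

/-! ### The distance to the half-sphere of radius `1/√b` -/

namespace HypSpace

theorem smul_fst (γ : SL(2, ℂ)) (x : HypSpace) : (γ • x).1.1 =
    ((γ 0 0 * x.1.1 + γ 0 1) * (starRingEnd ℂ) (γ 1 0 * x.1.1 + γ 1 1)
        + γ 0 0 * (starRingEnd ℂ) (γ 1 0) * (x.1.2 : ℂ) ^ 2) / (den γ x : ℂ) := rfl

theorem smul_snd (γ : SL(2, ℂ)) (x : HypSpace) : (γ • x).1.2 = x.1.2 / den γ x := rfl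

/-- The squared Euclidean norm of `γ • x` is the ratio of the values `|p z + q|² + |p|² t²` at the
two rows `(p, q)` of `γ`. -/
theorem normSq_smul_add_sq (γ : SL(2, ℂ)) (x : HypSpace) :
    Complex.normSq (γ • x).1.1 + (γ • x).1.2 ^ 2 =
      (Complex.normSq (γ 0 0 * x.1.1 + γ 0 1) + Complex.normSq (γ 0 0) * x.1.2 ^ 2) / den γ x := by
  have hD := den_pos γ x
  have hD' : ((den γ x : ℝ) : ℂ) ≠ 0 := by exact_mod_cast hD.ne'
  have hdet : γ 0 0 * γ 1 1 - γ 0 1 * γ 1 0 = 1 := by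
    rw [← Matrix.det_fin_two, γ.det_coe]
  have hdet' := congrArg (starRingEnd ℂ) hdet
  have hden : ((den γ x : ℝ) : ℂ) =
      (γ 1 0 * x.1.1 + γ 1 1) * (starRingEnd ℂ) (γ 1 0 * x.1.1 + γ 1 1)
        + γ 1 0 * (starRingEnd ℂ) (γ 1 0) * (x.1.2 : ℂ) ^ 2 := by
    rw [Complex.mul_conj, Complex.mul_conj]
    simp [den]
  apply Complex.ofReal_injective
  simp only [smul_fst, smul_snd, Complex.ofReal_add, Complex.ofReal_mul, ← Complex.mul_conj,
    Complex.ofReal_pow, Complex.ofReal_div, map_add, map_mul, map_div₀, Complex.conj_ofReal,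
    map_pow, Complex.conj_conj]
  simp only [map_sub, map_mul, map_one, map_add] at hdet' hden
  field_simp
  rw [hden]
  generalize (starRingEnd ℂ) (γ 0 0) = a' at *
  generalize (starRingEnd ℂ) (γ 0 1) = b' at *
  generalize (starRingEnd ℂ) (γ 1 0) = c' at *
  generalize (starRingEnd ℂ) (γ 1 1) = d' at *
  generalize (starRingEnd ℂ) x.1.1 = z' at *
  generalize γ 0 0 = a at *
  generalize γ 0 1 = b at *
  generalize γ 1 0 = c at *
  generalize γ 1 1 = d at *
  generalize x.1.1 = z at *
  generalize (x.1.2 : ℂ) = t at *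
  linear_combination (-t ^ 2) * (a' * d' - b' * c') * hdet + (-t ^ 2) * hdet'

/-- The function `(b (|z|² + t²) - 1) / t`, proportional to the hyperbolic sine of the signed
hyperbolic distance to the half-sphere `S(0, 1/√b)`. -/
noncomputable def height (b : ℕ) (x : HypSpace) : ℝ :=
  (b * (Complex.normSq x.1.1 + x.1.2 ^ 2) - 1) / x.1.2

theorem continuous_height (b : ℕ) : Continuous (height b) := by
  unfold height
  have h1 : Continuous fun x : HypSpace => x.1.2 := by fun_prop
  have h2 : Continuous fun x : HypSpace => Complex.normSq x.1.1 :=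
    Complex.continuous_normSq.comp (by fun_prop)
  exact (by fun_prop : Continuous fun x : HypSpace =>
    b * (Complex.normSq x.1.1 + x.1.2 ^ 2) - 1).div h1 fun x => x.2.ne'

theorem mem_halfSphere_iff {b : ℕ} (hb : 0 < b) (x : HypSpace) :
    x ∈ halfSphere 0 (1 / √(b : ℝ)) ↔ b * (Complex.normSq x.1.1 + x.1.2 ^ 2) = 1 := by
  have hb' : (0 : ℝ) < b := by exact_mod_cast hb
  simp only [halfSphere, sub_zero, Set.mem_ofPred_eq, div_pow, one_pow, Real.sq_sqrt hb'.le]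
  rw [eq_div_iff hb'.ne', mul_comm]

theorem mem_halfSphere_iff_height {b : ℕ} (hb : 0 < b) (x : HypSpace) :
    x ∈ halfSphere 0 (1 / √(b : ℝ)) ↔ height b x = 0 := by
  rw [mem_halfSphere_iff hb, height, div_eq_zero_iff, sub_eq_zero]
  simp [x.2.ne']

/-- The part of the half-sphere `S(0, 1/√b)` at height at least `ε` is compact. -/
theorem isCompact_halfSphere_inter {b : ℕ} (hb : 0 < b) {ε : ℝ} (hε : 0 < ε) :
    IsCompact (halfSphere 0 (1 / √(b : ℝ)) ∩ {x | ε ≤ x.1.2}) := by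
  have hb' : (0 : ℝ) < b := by exact_mod_cast hb
  rw [Subtype.isCompact_iff]
  have himg : (Subtype.val '' (halfSphere 0 (1 / √(b : ℝ)) ∩ {x | ε ≤ x.1.2}) : Set (ℂ × ℝ)) =
      {y | b * (Complex.normSq y.1 + y.2 ^ 2) = 1} ∩ {y | ε ≤ y.2} := by
    ext y
    constructor
    · rintro ⟨x, ⟨h1, h2⟩, rfl⟩
      exact ⟨(mem_halfSphere_iff hb x).1 h1, h2⟩
    · rintro ⟨h1, h2⟩
      exact ⟨⟨y, hε.trans_le h2⟩, ⟨(mem_halfSphere_iff hb _).2 h1, h2⟩, rfl⟩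
  rw [himg]
  apply Metric.isCompact_of_isClosed_isBounded
  · apply IsClosed.inter
    · apply isClosed_eq _ continuous_const
      have := Complex.continuous_normSq.comp (continuous_fst (X := ℂ) (Y := ℝ))
      simp only [Function.comp_def] at this
      fun_prop
    · exact isClosed_le continuous_const continuous_snd
  · apply (Metric.isBounded_closedBall (x := (0 : ℂ × ℝ)) (r := 1)).subset
    rintro ⟨z, t⟩ ⟨h1, -⟩
    have hb1 : (1 : ℝ) ≤ b := by exact_mod_cast hb
    simp only [Set.mem_ofPred_eq, Complex.normSq_eq_norm_sq] at h1
    have hs : 0 ≤ ‖z‖ ^ 2 + t ^ 2 := by positivity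
    have hle : ‖z‖ ^ 2 + t ^ 2 ≤ 1 := by nlinarith
    rw [mem_closedBall_zero_iff, Prod.norm_def, max_le_iff]
    constructor
    · nlinarith [norm_nonneg z, sq_nonneg t]
    · rw [Real.norm_eq_abs]
      exact abs_le_one_iff_mul_self_le_one.2 (by nlinarith [sq_nonneg ‖z‖])

/-- An itgs on which `height b` is bounded is the half-sphere `S(0, 1/√b)`: its boundary at
infinity has to lie in the circle `|z| = 1/√b`. -/
theorem IsItgs.eq_halfSphere_of_height_bounded {b : ℕ} (hb : 0 < b) {S : Set HypSpace}
    (hS : IsItgs S) {B : ℝ} (hB : ∀ x ∈ S, |height b x| ≤ B) :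
    S = halfSphere 0 (1 / √(b : ℝ)) := by
  have hb' : (0 : ℝ) < b := by exact_mod_cast hb
  -- A curve in `S` that tends to the boundary point `z 0` forces `b |z 0|² = 1`.
  have key : ∀ z : ℝ → ℂ, Continuous z → ∀ r : ℝ, 0 < r →
      (∀ (τ : ℝ) (h : 0 < r * τ), τ < 1 → (⟨(z τ, r * τ), h⟩ : HypSpace) ∈ S) →
      b * Complex.normSq (z 0) = 1 := by
    intro z hz r hr hmem
    have hc : Continuous fun τ : ℝ =>
        |b * (Complex.normSq (z τ) + (r * τ) ^ 2) - 1| - B * (r * τ) := by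
      have := Complex.continuous_normSq.comp hz
      simp only [Function.comp_def] at this
      fun_prop
    have hlim := (hc.tendsto 0).mono_left (nhdsWithin_le_nhds (s := Set.Ioi 0))
    have hle : |b * (Complex.normSq (z 0) + (r * 0) ^ 2) - 1| - B * (r * 0) ≤ 0 := by
      apply le_of_tendsto hlim
      filter_upwards [Ioo_mem_nhdsGT (zero_lt_one (α := ℝ))] with τ hτ
      have hp : 0 < r * τ := mul_pos hr hτ.1
      have h := hB _ (hmem τ hp hτ.2)
      rw [height, abs_div, abs_of_pos hp, div_le_iff₀ hp] at h
      linarith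
    simp only [mul_zero, ne_eq, OfNat.ofNat_ne_zero, not_false_eq_true, zero_pow, add_zero,
      sub_zero] at hle
    have := abs_eq_zero.1 (le_antisymm hle (abs_nonneg _))
    linarith
  rcases hS with ⟨c, r, hr, rfl⟩ | ⟨p, v, hv, rfl⟩
  · have h1 : ∀ w : ℂ, Complex.normSq w = 1 → b * Complex.normSq (c + r * w) = 1 := by
      intro w hw
      have := key (fun τ => c + r * (√(1 - τ ^ 2) : ℝ) * w) (by fun_prop) r hr ?_
      · simpa using this
      · intro τ hτ hτ1
        have hτ0 : 0 < τ := pos_of_mul_pos_right hτ hr.le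
        have h2 : 0 ≤ 1 - τ ^ 2 := by nlinarith
        simp only [halfSphere, Set.mem_ofPred_eq, add_sub_cancel_left, map_mul, hw,
          Complex.normSq_ofReal, Real.mul_self_sqrt h2]
        ring
    have e1 := h1 1 (by simp)
    have e2 := h1 (-1) (by simp)
    have e3 := h1 Complex.I (by simp)
    have e4 := h1 (-Complex.I) (by simp)
    simp only [Complex.normSq_apply, Complex.add_re, Complex.add_im, Complex.mul_re,
      Complex.mul_im, Complex.ofReal_re, Complex.ofReal_im, Complex.neg_re, Complex.neg_im,
      Complex.one_re, Complex.one_im, Complex.I_re, Complex.I_im] at e1 e2 e3 e4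
    have hbr : (b : ℝ) * r ≠ 0 := by positivity
    have hre : c.re = 0 := by
      apply (mul_eq_zero_iff_left hbr).1
      linarith
    have him : c.im = 0 := by
      apply (mul_eq_zero_iff_left hbr).1
      linarith
    have hc : c = 0 := Complex.ext hre him
    rw [hre, him] at e1
    have hr2 : r = 1 / √(b : ℝ) := by
      have : r ^ 2 = (1 / √(b : ℝ)) ^ 2 := by
        rw [div_pow, one_pow, Real.sq_sqrt hb'.le, eq_div_iff hb'.ne']
        linarith
      exact (pow_left_inj₀ hr.le (by positivity) two_ne_zero).1 this
    rw [hc, hr2]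
  · exfalso
    have h1 : ∀ s : ℝ, b * Complex.normSq (p + s * v) = 1 := fun s =>
      key (fun _ => p + s * v) continuous_const 1 one_pos fun τ hτ _ => ⟨s, rfl⟩
    have e0 := h1 0
    have e1 := h1 1
    have e2 := h1 (-1)
    have hv' := Complex.normSq_pos.2 hv
    simp only [Complex.normSq_apply, Complex.add_re, Complex.add_im, Complex.mul_re,
      Complex.mul_im, Complex.ofReal_re, Complex.ofReal_im] at e0 e1 e2 hv'
    have : (b : ℝ) * (v.re * v.re + v.im * v.im) = 0 := by linarith
    have h := mul_pos hb' hv'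
    linarith

end HypSpace

/-! ### Simultaneous Dirichlet approximation -/

/-- Simultaneous Dirichlet approximation for two linear forms in two integral variables, by the
pigeonhole principle. -/
theorem exists_int_approx (A₁ B₁ A₂ B₂ : ℝ) {Q : ℕ} (hQ : 0 < Q) :
    ∃ m n k l : ℤ, (m ≠ 0 ∨ n ≠ 0) ∧ |m| ≤ Q ∧ |n| ≤ Q ∧
      |A₁ * m + B₁ * n - k| ≤ 1 / Q ∧ |A₂ * m + B₂ * n - l| ≤ 1 / Q := by
  have hQ' : (0 : ℝ) < Q := by exact_mod_cast hQ
  let box : ℝ → ℕ := fun θ => ⌊Q * Int.fract θ⌋₊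
  have hbox : ∀ θ, box θ ∈ Finset.range Q := fun θ => by
    rw [Finset.mem_range, Nat.floor_lt (mul_nonneg hQ'.le (Int.fract_nonneg θ))]
    exact (mul_lt_iff_lt_one_right hQ').2 (Int.fract_lt_one θ)
  -- Two points in the same box differ by less than `1 / Q` modulo `1`.
  have hclose : ∀ θ θ', box θ = box θ' → |θ - θ' - ((⌊θ⌋ - ⌊θ'⌋ : ℤ) : ℝ)| ≤ 1 / Q := by
    intro θ θ' h
    have e : θ - θ' - ((⌊θ⌋ - ⌊θ'⌋ : ℤ) : ℝ) = Int.fract θ - Int.fract θ' := by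
      rw [Int.fract, Int.fract]; push_cast; ring
    have h1 := Nat.floor_le (mul_nonneg hQ'.le (Int.fract_nonneg θ))
    have h2 := Nat.lt_floor_add_one (Q * Int.fract θ)
    have h3 := Nat.floor_le (mul_nonneg hQ'.le (Int.fract_nonneg θ'))
    have h4 := Nat.lt_floor_add_one (Q * Int.fract θ')
    have h' : (⌊Q * Int.fract θ⌋₊ : ℝ) = ⌊Q * Int.fract θ'⌋₊ := by exact_mod_cast h
    rw [e, abs_le, ← neg_div, div_le_iff₀ hQ', le_div_iff₀ hQ']
    constructor <;> linarith
  let f : ℕ × ℕ → ℕ × ℕ := fun x => (box (A₁ * x.1 + B₁ * x.2), box (A₂ * x.1 + B₂ * x.2))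
  obtain ⟨x, hx, y, hy, hxy, hf⟩ := Finset.exists_ne_map_eq_of_card_lt_of_maps_to
    (s := Finset.range (Q + 1) ×ˢ Finset.range (Q + 1)) (t := Finset.range Q ×ˢ Finset.range Q)
    (by simp only [Finset.card_product, Finset.card_range]; nlinarith) (f := f)
    (fun x _ => by
      simpa only [f, Finset.coe_product, Set.mem_prod, Finset.mem_coe] using ⟨hbox _, hbox _⟩)
  simp only [Finset.mem_product, Finset.mem_range] at hx hy
  simp only [f, Prod.mk.injEq] at hf
  refine ⟨(x.1 : ℤ) - y.1, (x.2 : ℤ) - y.2, ⌊A₁ * x.1 + B₁ * x.2⌋ - ⌊A₁ * y.1 + B₁ * y.2⌋,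
    ⌊A₂ * x.1 + B₂ * x.2⌋ - ⌊A₂ * y.1 + B₂ * y.2⌋, ?_, ?_, ?_, ?_, ?_⟩
  rotate_left 3
  · convert hclose _ _ hf.1 using 2
    push_cast; ring
  · convert hclose _ _ hf.2 using 2
    push_cast; ring
  · by_contra! h
    exact hxy (Prod.ext (by omega) (by omega))
  · rw [abs_le]; omega
  · rw [abs_le]; omega

/-! ### Division algebras, orders and congruences -/

namespace QuatAlg

/-- For negative `a` the complex square root of `a` is purely imaginary. -/
theorem exists_root_eq {a : ℤ} (ha : a < 0) :
    ∃ s : ℝ, s ≠ 0 ∧ s ^ 2 = -a ∧ root a = s * Complex.I := by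
  have h := root_mul_root a
  have ha' : (a : ℝ) < 0 := by exact_mod_cast ha
  have hre := congrArg Complex.re h
  have him := congrArg Complex.im h
  simp only [Complex.mul_re, Complex.mul_im, Complex.intCast_re, Complex.intCast_im] at hre him
  have h1 : (root a).im ≠ 0 := by
    intro h0
    rw [h0] at hre
    nlinarith [sq_nonneg (root a).re]
  have h2 : (root a).re = 0 := by
    apply (mul_eq_zero_iff_left h1).1
    linarith
  refine ⟨(root a).im, h1, ?_, Complex.ext (by simp [h2]) (by simp)⟩
  rw [h2] at hre
  linarith

theorem nrd_ne_zero {a : ℤ} {b : ℕ}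
    (hdiv : ∀ α : QuatAlg a b, α ≠ 0 → IsUnit α) {α : QuatAlg a b} (hα : α ≠ 0) :
    nrd α ≠ 0 := by
  intro h
  have h1 := nrd_spec α
  rw [h, map_zero] at h1
  have h2 := (hdiv α hα).mul_right_eq_zero.1 h1
  exact hα (star_eq_zero.1 h2)

end QuatAlg

namespace QuatOrder

variable {a : ℤ} {b : ℕ} (O : QuatOrder a b)

/-- An order spans the quaternion algebra over `ℚ`, so that every element has a positive integral
multiple in the order. -/
theorem exists_nsmul_mem (α : QuatAlg a b) : ∃ m : ℕ, m ≠ 0 ∧ m • α ∈ O.toSubring := by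
  obtain ⟨e, he, hcl⟩ := O.exists_generators
  have hspan : Submodule.span ℚ (Set.range e) = ⊤ := by
    apply he.span_eq_top_of_card_eq_finrank
    rw [QuaternionAlgebra.finrank_eq_four, Fintype.card_fin]
  have hα : α ∈ Submodule.span ℚ (Set.range e) := hspan ▸ Submodule.mem_top
  induction hα using Submodule.span_induction with
  | mem x hx =>
    refine ⟨1, one_ne_zero, ?_⟩
    rw [one_smul, ← Subring.mem_toAddSubgroup, ← hcl]
    exact AddSubgroup.subset_closure hx
  | zero => exact ⟨1, one_ne_zero, by simp⟩
  | add x y _ _ hx hy =>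
    obtain ⟨m, hm, hx⟩ := hx
    obtain ⟨n, hn, hy⟩ := hy
    refine ⟨n * m, mul_ne_zero hn hm, ?_⟩
    rw [smul_add]
    refine add_mem ?_ ?_
    · rw [mul_smul]
      exact nsmul_mem hx n
    · rw [mul_comm, mul_smul]
      exact nsmul_mem hy m
  | smul q x _ hx =>
    obtain ⟨m, hm, hx⟩ := hx
    refine ⟨q.den * m, mul_ne_zero q.den_ne_zero hm, ?_⟩
    have : (q.den * m) • q • x = q.num • m • x := by
      simp only [← Nat.cast_smul_eq_nsmul ℚ, ← Int.cast_smul_eq_zsmul ℚ, smul_smul]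
      congr 1
      push_cast
      linear_combination (m : ℚ) * q.den_mul_eq_num
    rw [this]
    exact zsmul_mem hx _

/-- Some positive multiple of the lattice of integral coordinates lies in the order. -/
theorem exists_nsmul_mk_mem : ∃ m : ℕ, m ≠ 0 ∧ ∀ k₀ k₁ k₂ k₃ : ℤ,
    m • (⟨k₀, k₁, k₂, k₃⟩ : QuatAlg a b) ∈ O.toSubring := by
  obtain ⟨m₁, h₁, e₁⟩ := O.exists_nsmul_mem ⟨0, 1, 0, 0⟩
  obtain ⟨m₂, h₂, e₂⟩ := O.exists_nsmul_mem ⟨0, 0, 1, 0⟩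
  obtain ⟨m₃, h₃, e₃⟩ := O.exists_nsmul_mem ⟨0, 0, 0, 1⟩
  refine ⟨m₁ * m₂ * m₃, by positivity, fun k₀ k₁ k₂ k₃ => ?_⟩
  have : (m₁ * m₂ * m₃) • (⟨k₀, k₁, k₂, k₃⟩ : QuatAlg a b) =
      (m₁ * m₂ * m₃ * k₀) • (1 : QuatAlg a b) + (m₂ * m₃ * k₁) • m₁ • (⟨0, 1, 0, 0⟩ : QuatAlg a b)
      + (m₁ * m₃ * k₂) • m₂ • (⟨0, 0, 1, 0⟩ : QuatAlg a b)
      + (m₁ * m₂ * k₃) • m₃ • (⟨0, 0, 0, 1⟩ : QuatAlg a b) := by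
    ext <;> simp <;> ring
  rw [this]
  exact add_mem (add_mem (add_mem (zsmul_mem (one_mem _) _) (zsmul_mem e₁ _)) (zsmul_mem e₂ _))
    (zsmul_mem e₃ _)

/-- The coordinates modulo `n` with respect to four generators separate the classes of the order
modulo `n`. For `n ≠ 0` they take finitely many values. -/
theorem exists_finite_classes (n : ℤ) :
    ∃ f : O.toSubring → (Fin 4 → ZMod n.natAbs), ∀ α β : O.toSubring, f α = f β →
      ∃ γ ∈ O.toSubring, (α : QuatAlg a b) = β + n • γ := by
  obtain ⟨e, -, hcl⟩ := O.exists_generators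
  have hmem : ∀ i, e i ∈ O.toSubring := fun i => by
    rw [← Subring.mem_toAddSubgroup, ← hcl]
    exact AddSubgroup.subset_closure ⟨i, rfl⟩
  have hex : ∀ α : O.toSubring, ∃ k : Fin 4 → ℤ, ∑ i, k i • e i = (α : QuatAlg a b) := by
    intro α
    have h : (α : QuatAlg a b) ∈ AddSubgroup.closure (Set.range e) := by
      rw [hcl]
      exact α.2
    rw [← Submodule.span_int_eq_addSubgroupClosure, Submodule.mem_toAddSubgroup] at h
    exact (Submodule.mem_span_range_iff_exists_fun ℤ).1 h
  choose k hk using hex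
  refine ⟨fun α i => k α i, fun α β h => ?_⟩
  have hdvd : ∀ i, n ∣ k α i - k β i := fun i => by
    rw [← Int.natAbs_dvd, ← ZMod.intCast_zmod_eq_zero_iff_dvd, Int.cast_sub, sub_eq_zero]
    exact congrFun h i
  choose l hl using hdvd
  refine ⟨∑ i, l i • e i, sum_mem fun i _ => zsmul_mem (hmem i) _, ?_⟩
  rw [← hk α, ← hk β, Finset.smul_sum, ← Finset.sum_add_distrib]
  refine Finset.sum_congr rfl fun i _ => ?_
  rw [smul_smul, ← hl i, ← add_smul, add_sub_cancel]

/-- Elements `α` of norm `n ≠ 0` have, modulo `n`, representatives `β` of norm `n` on which a given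
function is bounded. -/
theorem exists_bounded_representative (g : QuatAlg a b → ℝ) {n : ℤ} (hn : n ≠ 0) :
    ∃ C : ℝ, ∀ α ∈ O.toSubring, QuatAlg.nrd α = n → ∃ β ∈ O.toSubring, QuatAlg.nrd β = n ∧
      g β ≤ C ∧ ∃ γ ∈ O.toSubring, α = β + n • γ := by
  obtain ⟨f, hf⟩ := O.exists_finite_classes n
  have : NeZero n.natAbs := ⟨Int.natAbs_ne_zero.2 hn⟩
  let s : Set (Fin 4 → ZMod n.natAbs) :=
    {c | ∃ α : O.toSubring, QuatAlg.nrd (α : QuatAlg a b) = n ∧ f α = c}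
  have hs : ∀ c : s, ∃ α : O.toSubring, QuatAlg.nrd (α : QuatAlg a b) = n ∧ f α = c := fun c => c.2
  choose r hr using hs
  obtain ⟨C, hC⟩ := (Set.finite_range fun c : s => g (r c)).bddAbove
  refine ⟨C, fun α hα hα' => ?_⟩
  let c : s := ⟨f ⟨α, hα⟩, ⟨α, hα⟩, hα', rfl⟩
  obtain ⟨γ, hγ, h⟩ := hf ⟨α, hα⟩ (r c) (hr c).2.symm
  exact ⟨r c, (r c).2, (hr c).1, hC ⟨c, rfl⟩, γ, hγ, h⟩

/-- If `α ≡ β` modulo the common norm `n` of `α` and `β`, then `β⁻¹ α = β̄ α / n` is a unit of norm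
one of the order. -/
theorem exists_unit_of_congr {α β γ : QuatAlg a b} {n : ℤ} (hn : n ≠ 0) (hβ : β ∈ O.toSubring)
    (hγ : γ ∈ O.toSubring) (nα : QuatAlg.nrd α = n) (nβ : QuatAlg.nrd β = n)
    (h : α = β + n • γ) :
    ∃ υ ∈ O.toSubring, QuatAlg.nrd υ = 1 ∧ n • υ = star β * α := by
  have hn' : (n : ℚ) ≠ 0 := by exact_mod_cast hn
  have e : n • (1 + star β * γ) = star β * α := by
    have h1 := QuatAlg.nrd_spec (star β)
    rw [star_star, QuatAlg.nrd_star, nβ] at h1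
    rw [h, mul_add, h1, smul_add, mul_smul_comm]
    simp [zsmul_eq_mul]
  refine ⟨1 + star β * γ, add_mem (one_mem _) (mul_mem (O.star_mem hβ) hγ), ?_, e⟩
  have h2 := congrArg QuatAlg.nrd e
  have h3 : (n • (1 + star β * γ)) = (n : QuatAlg a b) * (1 + star β * γ) := zsmul_eq_mul _ _
  have h4 : QuatAlg.nrd (n : QuatAlg a b) = (n : ℚ) ^ 2 := by simp [QuatAlg.nrd_eq]
  rw [QuatAlg.nrd_mul, QuatAlg.nrd_star, nα, nβ, h3, QuatAlg.nrd_mul, h4] at h2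
  apply mul_left_cancel₀ (pow_ne_zero 2 hn')
  linear_combination h2

end QuatOrder

/-! ### The Hermitian form at the rows of the representation -/

namespace QuatAlg

open HypSpace

variable {a : ℤ} {b : ℕ}

theorem rep_one_one (ha : a < 0) (α : QuatAlg a b) :
    rep a b α 1 1 = (starRingEnd ℂ) (rep a b α 0 0) := by
  obtain ⟨s, -, -, hr⟩ := exists_root_eq ha
  simp [rep, hr, sub_eq_add_neg]

theorem rep_one_zero (ha : a < 0) (α : QuatAlg a b) :
    rep a b α 1 0 = b * (starRingEnd ℂ) (rep a b α 0 1) := by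
  obtain ⟨s, -, -, hr⟩ := exists_root_eq ha
  simp [rep, hr, sub_eq_add_neg]

/-- The value `|p z + q|² + |p|² t²` at the `i`-th row `(p, q)` of the matrix of `α`; for the
second row and norm one it is the denominator of the Poincaré extension. -/
noncomputable def rowForm (i : Fin 2) (α : QuatAlg a b) (x : HypSpace) : ℝ :=
  Complex.normSq (rep a b α i 0 * x.1.1 + rep a b α i 1) +
    Complex.normSq (rep a b α i 0) * x.1.2 ^ 2

theorem rowForm_nonneg (i : Fin 2) (α : QuatAlg a b) (x : HypSpace) : 0 ≤ rowForm i α x :=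
  add_nonneg (Complex.normSq_nonneg _) (mul_nonneg (Complex.normSq_nonneg _) (sq_nonneg _))

theorem rowForm_nsmul (i : Fin 2) (m : ℕ) (α : QuatAlg a b) (x : HypSpace) :
    rowForm i (m • α) x = m ^ 2 * rowForm i α x := by
  have h : ∀ j, rep a b (m • α) i j = (m : ℝ) * rep a b α i j := fun j => by
    rw [map_nsmul]
    simp
  rw [rowForm, rowForm, h, h, mul_assoc, ← mul_add, map_mul, map_mul, Complex.normSq_ofReal]
  ring

theorem nrd_eq_rep (α : QuatAlg a b) :
    (nrd α : ℂ) = rep a b α 0 0 * rep a b α 1 1 - rep a b α 0 1 * rep a b α 1 0 := by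
  rw [← det_rep, Matrix.det_fin_two]

/-- The matrix of `α` is a similitude of factor `nrd α` for the Hermitian form of signature `(1, 1)`
that defines the half-sphere `S(0, 1/√b)`. -/
theorem rowForm_sub (ha : a < 0) (α : QuatAlg a b) (x : HypSpace) :
    b * rowForm 0 α x - rowForm 1 α x =
      nrd α * (b * (Complex.normSq x.1.1 + x.1.2 ^ 2) - 1) := by
  have hn := congrArg Complex.re (nrd_eq_rep α)
  rw [rep_one_one ha, rep_one_zero ha] at hn
  simp only [rowForm, rep_one_one ha, rep_one_zero ha]
  generalize rep a b α 0 0 = ξ at *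
  generalize rep a b α 0 1 = η at *
  have hn' : (nrd α : ℝ) = ξ.re ^ 2 + ξ.im ^ 2 - b * (η.re ^ 2 + η.im ^ 2) := by
    simp at hn
    rw [hn]
    ring
  rw [hn']
  simp [Complex.normSq_apply]
  ring

theorem mul_rowForm_zero_eq (ha : a < 0) (hb : 0 < b) (α : QuatAlg a b) {x : HypSpace}
    (hx : x ∈ halfSphere 0 (1 / √(b : ℝ))) : b * rowForm 0 α x = rowForm 1 α x := by
  have h := rowForm_sub ha α x
  rw [(mem_halfSphere_iff hb x).1 hx] at h
  linarith

theorem rowForm_zero_le (ha : a < 0) (hb : 0 < b) (α : QuatAlg a b) {x : HypSpace}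
    (hx : x ∈ halfSphere 0 (1 / √(b : ℝ))) : rowForm 0 α x ≤ rowForm 1 α x := by
  rw [← mul_rowForm_zero_eq ha hb α hx]
  have : (1 : ℝ) ≤ b := by exact_mod_cast hb
  nlinarith [rowForm_nonneg 0 α x]

/-- On the half-sphere `S(0, 1/√b)` the norm is controlled by the values at the rows (an instance
of Hadamard's determinant inequality). -/
theorem abs_nrd_mul_le (ha : a < 0) (hb : 0 < b) (α : QuatAlg a b) {x : HypSpace}
    (hx : x ∈ halfSphere 0 (1 / √(b : ℝ))) : |(nrd α : ℝ)| * x.1.2 ≤ rowForm 1 α x := by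
  have h0 := rowForm_zero_le ha hb α hx
  have ht := x.2
  have hdet : ((nrd α * x.1.2 : ℝ) : ℂ) =
      (rep a b α 0 0 * x.1.2) * (rep a b α 1 0 * x.1.1 + rep a b α 1 1) -
      (rep a b α 0 0 * x.1.1 + rep a b α 0 1) * (rep a b α 1 0 * x.1.2) := by
    push_cast
    rw [nrd_eq_rep]
    ring
  have h := congrArg norm hdet
  rw [Complex.norm_real, Real.norm_eq_abs, abs_mul, abs_of_pos ht] at h
  rw [h]
  refine (norm_sub_le _ _).trans ?_
  simp only [rowForm, Complex.normSq_eq_norm_sq] at h0 ⊢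
  simp only [norm_mul, Complex.norm_real, Real.norm_eq_abs, abs_of_pos ht]
  nlinarith [sq_nonneg (‖rep a b α 0 0‖ * x.1.2 - ‖rep a b α 1 0 * x.1.1 + rep a b α 1 1‖),
    sq_nonneg (‖rep a b α 0 0 * x.1.1 + rep a b α 0 1‖ - ‖rep a b α 1 0‖ * x.1.2)]

theorem normSq_add_le (z w : ℂ) :
    Complex.normSq (z + w) ≤ 2 * Complex.normSq z + 2 * Complex.normSq w := by
  simp only [Complex.normSq_apply, Complex.add_re, Complex.add_im]
  nlinarith [sq_nonneg (z.re - w.re), sq_nonneg (z.im - w.im)]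

/-- Twice the squared length of the second row of the matrix of `ᾱ`. -/
noncomputable def starRowSize (α : QuatAlg a b) : ℝ :=
  2 * (Complex.normSq (rep a b (star α) 1 0) + Complex.normSq (rep a b (star α) 1 1))

theorem starRowSize_nonneg (α : QuatAlg a b) : 0 ≤ starRowSize α :=
  mul_nonneg zero_le_two (add_nonneg (Complex.normSq_nonneg _) (Complex.normSq_nonneg _))

/-- If `n υ = β̄ α`, the second row of the matrix of `υ` is small when that of `α` is, up to a
factor that depends on `β` only. -/
theorem rowForm_star_mul_le (ha : a < 0) (hb : 0 < b) {α β υ : QuatAlg a b} {n : ℤ} (hn : n ≠ 0)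
    (h : n • υ = star β * α) {x : HypSpace} (hx : x ∈ halfSphere 0 (1 / √(b : ℝ))) :
    rowForm 1 υ x ≤ starRowSize β * rowForm 1 α x := by
  have h0 := rowForm_zero_le ha hb α hx
  have hm : ∀ j, ((n : ℝ) : ℂ) * rep a b υ 1 j = rep a b (star β) 1 0 * rep a b α 0 j +
      rep a b (star β) 1 1 * rep a b α 1 j := fun j => by
    have := congrFun (congrFun (congrArg (rep a b) h) 1) j
    rw [map_mul, Matrix.mul_apply, Fin.sum_univ_two, map_zsmul] at this
    rw [← this]
    simp
  have hn1 : (1 : ℝ) ≤ (n : ℝ) ^ 2 := by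
    have : (1 : ℤ) ≤ n ^ 2 := Order.one_le_iff_pos.2 (by positivity)
    exact_mod_cast this
  have e1 : (n : ℝ) ^ 2 * rowForm 1 υ x =
      Complex.normSq (rep a b (star β) 1 0 * (rep a b α 0 0 * x.1.1 + rep a b α 0 1) +
        rep a b (star β) 1 1 * (rep a b α 1 0 * x.1.1 + rep a b α 1 1)) +
      Complex.normSq (rep a b (star β) 1 0 * rep a b α 0 0 +
        rep a b (star β) 1 1 * rep a b α 1 0) * x.1.2 ^ 2 := by
    rw [← hm 0]
    have : rep a b (star β) 1 0 * (rep a b α 0 0 * x.1.1 + rep a b α 0 1) +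
        rep a b (star β) 1 1 * (rep a b α 1 0 * x.1.1 + rep a b α 1 1) =
        ((n : ℝ) : ℂ) * (rep a b υ 1 0 * x.1.1 + rep a b υ 1 1) := by
      linear_combination (-x.1.1) * hm 0 - hm 1
    rw [this, map_mul, map_mul, Complex.normSq_ofReal, rowForm]
    ring
  have e2 := normSq_add_le (rep a b (star β) 1 0 * (rep a b α 0 0 * x.1.1 + rep a b α 0 1))
    (rep a b (star β) 1 1 * (rep a b α 1 0 * x.1.1 + rep a b α 1 1))
  have e3 := mul_le_mul_of_nonneg_right (normSq_add_le (rep a b (star β) 1 0 * rep a b α 0 0)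
    (rep a b (star β) 1 1 * rep a b α 1 0)) (sq_nonneg x.1.2)
  simp only [map_mul] at e2 e3
  have e4 : (n : ℝ) ^ 2 * rowForm 1 υ x ≤
      2 * Complex.normSq (rep a b (star β) 1 0) * rowForm 0 α x +
      2 * Complex.normSq (rep a b (star β) 1 1) * rowForm 1 α x := by
    rw [e1]
    simp only [rowForm]
    linarith
  calc rowForm 1 υ x ≤ (n : ℝ) ^ 2 * rowForm 1 υ x :=
        le_mul_of_one_le_left (rowForm_nonneg 1 υ x) hn1
    _ ≤ _ := e4
    _ ≤ starRowSize β * rowForm 1 α x := by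
        have := mul_le_mul_of_nonneg_left h0 (Complex.normSq_nonneg (rep a b (star β) 1 0))
        rw [starRowSize]
        linarith

/-- A nonzero element with integral coordinates can be found whose second row is small at a given
point of height `t ≤ 1`: the first two coordinates approximate linear forms in the last two, which
are of size at most about `1/√t`. -/
theorem exists_mk_rowForm_le (ha : a < 0) (b : ℕ) : ∃ C : ℝ, ∀ x : HypSpace, x.1.2 ≤ 1 →
    ∃ k₀ k₁ k₂ k₃ : ℤ, (⟨k₀, k₁, k₂, k₃⟩ : QuatAlg a b) ≠ 0 ∧
      rowForm 1 (⟨k₀, k₁, k₂, k₃⟩ : QuatAlg a b) x ≤ C * x.1.2 := by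
  obtain ⟨s, hs, -, hr⟩ := exists_root_eq ha
  refine ⟨(1 + s ^ 2) * (1 + 4 * b ^ 2), fun x hx1 => ?_⟩
  have ht := x.2
  have hst := Real.sqrt_pos.2 ht
  have hsq := Real.sq_sqrt ht.le
  have hst1 : √x.1.2 ≤ 1 := Real.sqrt_le_one.2 hx1
  obtain ⟨Q, hQ1, hQ2⟩ : ∃ Q : ℕ, 1 ≤ Q * √x.1.2 ∧ Q * √x.1.2 ≤ 2 := by
    refine ⟨⌈1 / √x.1.2⌉₊, ?_, ?_⟩
    · exact (div_le_iff₀ hst).1 (Nat.le_ceil _)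
    · have h1 := Nat.ceil_lt_add_one (a := 1 / √x.1.2) (by positivity)
      have h2 := mul_lt_mul_of_pos_right h1 hst
      rw [add_mul, div_mul_cancel₀ _ hst.ne'] at h2
      linarith
  have hQ0 : 0 < Q := by
    rcases Nat.eq_zero_or_pos Q with h | h
    · rw [h] at hQ1
      norm_num at hQ1
    · exact h
  have hQ' : (0 : ℝ) < Q := by exact_mod_cast hQ0
  have hQa : (1 / (Q : ℝ)) ^ 2 ≤ x.1.2 := by
    have : 1 / (Q : ℝ) ≤ √x.1.2 := by
      rw [div_le_iff₀ hQ']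
      linarith
    calc (1 / (Q : ℝ)) ^ 2 ≤ √x.1.2 ^ 2 := pow_le_pow_left₀ (by positivity) this 2
      _ = x.1.2 := hsq
  have hQb : (Q : ℝ) ^ 2 * x.1.2 ≤ 4 := by
    calc (Q : ℝ) ^ 2 * x.1.2 = (Q * √x.1.2) ^ 2 := by rw [mul_pow, hsq]
      _ ≤ 2 ^ 2 := pow_le_pow_left₀ (by positivity) hQ2 2
      _ = 4 := by norm_num
  obtain ⟨m, n, k, l, hmn, hm, hn, hk, hl⟩ := exists_int_approx (-(b * x.1.1.re))
    (-(b * s * x.1.1.im)) (b / s * x.1.1.im) (-(b * x.1.1.re)) hQ0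
  refine ⟨k, l, m, n, ?_, ?_⟩
  · intro h
    have h2 := congrArg QuaternionAlgebra.imJ h
    have h3 := congrArg QuaternionAlgebra.imK h
    simp only [QuaternionAlgebra.imJ_zero, QuaternionAlgebra.imK_zero] at h2 h3
    rcases hmn with h' | h'
    · exact h' (by exact_mod_cast h2)
    · exact h' (by exact_mod_cast h3)
  · have hsq_le : ∀ {c : ℤ}, |c| ≤ (Q : ℤ) → (c : ℝ) ^ 2 ≤ (Q : ℝ) ^ 2 := fun h => by
      apply sq_le_sq'
      · exact_mod_cast (abs_le.1 h).1
      · exact_mod_cast (abs_le.1 h).2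
    have hm2 := hsq_le hm
    have hn2 := hsq_le hn
    have hk2 := (sq_le_sq' (abs_le.1 hk).1 (abs_le.1 hk).2).trans hQa
    have hl2 := (sq_le_sq' (abs_le.1 hl).1 (abs_le.1 hl).2).trans hQa
    have e : rowForm 1 (⟨k, l, m, n⟩ : QuatAlg a b) x =
        (-(b * x.1.1.re) * m + -(b * s * x.1.1.im) * n - k) ^ 2 +
        s ^ 2 * (b / s * x.1.1.im * m + -(b * x.1.1.re) * n - l) ^ 2 +
        b ^ 2 * (m ^ 2 + s ^ 2 * n ^ 2) * x.1.2 ^ 2 := by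
      simp [rowForm, rep, hr, Complex.normSq_apply]
      field_simp
      ring
    have e1 : (m : ℝ) ^ 2 + s ^ 2 * n ^ 2 ≤ (1 + s ^ 2) * Q ^ 2 := by
      nlinarith [sq_nonneg s]
    have e2 : ((m : ℝ) ^ 2 + s ^ 2 * n ^ 2) * x.1.2 ^ 2 ≤ (1 + s ^ 2) * (4 * x.1.2) :=
      calc ((m : ℝ) ^ 2 + s ^ 2 * n ^ 2) * x.1.2 ^ 2
          ≤ (1 + s ^ 2) * Q ^ 2 * x.1.2 ^ 2 := mul_le_mul_of_nonneg_right e1 (sq_nonneg _)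
        _ = (1 + s ^ 2) * (Q ^ 2 * x.1.2 * x.1.2) := by ring
        _ ≤ (1 + s ^ 2) * (4 * x.1.2) := by gcongr
    have e3 := mul_le_mul_of_nonneg_left e2 (sq_nonneg (b : ℝ))
    have e4 := mul_le_mul_of_nonneg_left hl2 (sq_nonneg s)
    rw [e]
    linarith

end QuatAlg

/-! ### The action of the group and compactness -/

namespace QuatOrder

open HypSpace

variable {a : ℤ} {b : ℕ} (O : QuatOrder a b)

theorem exists_mem_rowForm_le (ha : a < 0) : ∃ C : ℝ, ∀ x : HypSpace, x.1.2 ≤ 1 →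
    ∃ α ∈ O.toSubring, α ≠ 0 ∧ QuatAlg.rowForm 1 α x ≤ C * x.1.2 := by
  obtain ⟨m, hm, hO⟩ := O.exists_nsmul_mk_mem
  obtain ⟨C, hC⟩ := QuatAlg.exists_mk_rowForm_le ha b
  refine ⟨m ^ 2 * C, fun x hx => ?_⟩
  obtain ⟨k₀, k₁, k₂, k₃, hne, hle⟩ := hC x hx
  refine ⟨_, hO k₀ k₁ k₂ k₃, ?_, ?_⟩
  · rw [← Nat.cast_smul_eq_nsmul ℚ]
    exact smul_ne_zero (Nat.cast_ne_zero.2 hm) hne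
  · rw [QuatAlg.rowForm_nsmul, mul_assoc]
    gcongr

theorem den_eq_rowForm {γ : SL(2, ℂ)} {α : QuatAlg a b}
    (h : (γ : Matrix (Fin 2) (Fin 2) ℂ) = QuatAlg.rep a b α) (x : HypSpace) :
    den γ x = QuatAlg.rowForm 1 α x := by
  rw [den, QuatAlg.rowForm, ← h]

/-- The signed distance to `S(0, 1/√b)` is invariant under `Γ`. -/
theorem height_smul (ha : a < 0) {γ : SL(2, ℂ)} (hγ : γ ∈ O.Γ) (x : HypSpace) :
    height b (γ • x) = height b x := by
  obtain ⟨α, -, nα, hα⟩ := hγ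
  have hD := den_pos γ x
  have ht := x.2
  have h := QuatAlg.rowForm_sub ha α x
  rw [← den_eq_rowForm hα x, nα] at h
  have h0 : QuatAlg.rowForm 0 α x = Complex.normSq (γ 0 0 * x.1.1 + γ 0 1) +
      Complex.normSq (γ 0 0) * x.1.2 ^ 2 := by
    rw [QuatAlg.rowForm, ← hα]
  rw [height, normSq_smul_add_sq, smul_snd, ← h0, height]
  rw [Rat.cast_one, one_mul] at h
  rw [← h]
  field_simp

theorem smul_mem_halfSphere (ha : a < 0) (hb : 0 < b) {γ : SL(2, ℂ)} (hγ : γ ∈ O.Γ)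
    {x : HypSpace} (hx : x ∈ halfSphere 0 (1 / √(b : ℝ))) :
    γ • x ∈ halfSphere 0 (1 / √(b : ℝ)) := by
  rw [mem_halfSphere_iff_height hb, O.height_smul ha hγ]
  exact (mem_halfSphere_iff_height hb x).1 hx

/-- When the algebra is a division algebra, every point of `S(0, 1/√b)` can be moved by `Γ` to a
height bounded from below. -/
theorem exists_le_snd_smul (ha : a < 0) (hb : 0 < b)
    (hdiv : ∀ α : QuatAlg a b, α ≠ 0 → IsUnit α) :
    ∃ ε : ℝ, 0 < ε ∧ ∀ x ∈ halfSphere 0 (1 / √(b : ℝ)), ∃ γ ∈ O.Γ, ε ≤ (γ • x).1.2 := by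
  obtain ⟨C, hC⟩ := O.exists_mem_rowForm_le ha
  have hrep : ∀ n : ℤ, ∃ D : ℝ, n ≠ 0 → ∀ α ∈ O.toSubring, QuatAlg.nrd α = n →
      ∃ β ∈ O.toSubring, QuatAlg.nrd β = n ∧ QuatAlg.starRowSize β ≤ D ∧
        ∃ γ ∈ O.toSubring, α = β + n • γ := fun n => by
    by_cases hn : n = 0
    · exact ⟨0, fun h => absurd hn h⟩
    · obtain ⟨D, hD⟩ := O.exists_bounded_representative QuatAlg.starRowSize hn
      exact ⟨D, fun _ => hD⟩
  choose D hD using hrep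
  -- Only finitely many norms occur among the elements with a small second row.
  obtain ⟨E, hE⟩ := ((Set.finite_Icc (-⌊C⌋) ⌊C⌋).image D).bddAbove
  have hpos : 0 < |E| * |C| + 1 := by positivity
  refine ⟨1 / (|E| * |C| + 1), by positivity, fun x hx => ?_⟩
  have ht := x.2
  have hx1 : x.1.2 ≤ 1 := by
    have h1 := (mem_halfSphere_iff hb x).1 hx
    have hb1 : (1 : ℝ) ≤ b := by exact_mod_cast hb
    have h2 := Complex.normSq_nonneg x.1.1
    nlinarith [sq_nonneg x.1.2]
  obtain ⟨α, hα, hα0, hle⟩ := hC x hx1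
  obtain ⟨n, hn⟩ := O.nrd_int α hα
  have hn0 : n ≠ 0 := by
    rintro rfl
    exact QuatAlg.nrd_ne_zero hdiv hα0 (by simpa using hn)
  have hnC : n ∈ Set.Icc (-⌊C⌋) ⌊C⌋ := by
    have h1 := (QuatAlg.abs_nrd_mul_le ha hb α hx).trans hle
    rw [hn] at h1
    have h2 := le_of_mul_le_mul_right h1 ht
    rw [Set.mem_Icc, ← abs_le, Int.le_floor, Int.cast_abs]
    simpa using h2
  obtain ⟨β, hβ, nβ, hsize, γ, hγ, hαβ⟩ := hD n hn0 α hα hn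
  obtain ⟨υ, hυ, nυ, hυe⟩ := O.exists_unit_of_congr hn0 hβ hγ hn nβ hαβ
  let g : SL(2, ℂ) := ⟨QuatAlg.rep a b υ, by rw [QuatAlg.det_rep, nυ, Rat.cast_one]⟩
  refine ⟨g, ⟨υ, hυ, nυ, rfl⟩, ?_⟩
  have h3 := QuatAlg.rowForm_star_mul_le ha hb hn0 hυe hx
  have h4 : QuatAlg.starRowSize β ≤ |E| :=
    hsize.trans ((hE ⟨n, hnC, rfl⟩).trans (le_abs_self E))
  have h5 : QuatAlg.rowForm 1 α x ≤ |C| * x.1.2 :=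
    hle.trans (mul_le_mul_of_nonneg_right (le_abs_self C) ht.le)
  have h6 : QuatAlg.rowForm 1 υ x ≤ |E| * (|C| * x.1.2) :=
    h3.trans (mul_le_mul h4 h5 (QuatAlg.rowForm_nonneg 1 α x) (abs_nonneg E))
  rw [smul_snd, div_le_div_iff₀ hpos (den_pos g x), den_eq_rowForm rfl x]
  linarith

/-- The projection of `S(0, 1/√b)` equals that of its compact part above a fixed height. -/
theorem isClosedFor_halfSphere (ha : a < 0) (hb : 0 < b)
    (hdiv : ∀ α : QuatAlg a b, α ≠ 0 → IsUnit α) :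
    O.IsClosedFor (halfSphere 0 (1 / √(b : ℝ))) := by
  obtain ⟨ε, hε, h⟩ := O.exists_le_snd_smul ha hb hdiv
  have himg : O.π '' halfSphere 0 (1 / √(b : ℝ)) =
      O.π '' (halfSphere 0 (1 / √(b : ℝ)) ∩ {x | ε ≤ x.1.2}) := by
    refine Set.Subset.antisymm ?_ (Set.image_mono Set.inter_subset_left)
    rintro _ ⟨x, hx, rfl⟩
    obtain ⟨γ, hγ, hle⟩ := h x hx
    refine ⟨γ • x, ⟨O.smul_mem_halfSphere ha hb hγ hx, hle⟩, ?_⟩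
    exact Quotient.sound (MulAction.orbitRel_apply.2 ⟨⟨γ, hγ⟩, rfl⟩)
  rw [IsClosedFor, himg]
  exact (isCompact_halfSphere_inter hb hε).image continuous_quotient_mk'

/-- On an itgs with compact projection the signed distance to `S(0, 1/√b)` is bounded. -/
theorem IsClosedFor.exists_height_le (ha : a < 0) {S : Set HypSpace} (hS : O.IsClosedFor S) :
    ∃ B : ℝ, ∀ x ∈ S, |height b x| ≤ B := by
  let F : O.X → ℝ := Quotient.lift (height b) fun x y h => by
    obtain ⟨γ, rfl⟩ := MulAction.orbitRel_apply.1 h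
    exact O.height_smul ha γ.2 y
  have hF : Continuous F := (continuous_height b).quotient_lift _
  obtain ⟨B, hB⟩ := hS.exists_bound_of_continuousOn hF.continuousOn
  exact ⟨B, fun x hx => hB _ ⟨x, hx, rfl⟩⟩

end QuatOrder

theorem mainTheorem7 (a : ℤ) (b : ℕ) [Fact b.Prime] (O : QuatOrder a b) (hO : O.IsK2S) :
    HypSpace.IsItgs (HypSpace.halfSphere 0 (1 / √(b : ℝ))) ∧
    (∀ γ ∈ O.Γ, (fun x => γ • x) '' HypSpace.halfSphere 0 (1 / √(b : ℝ)) =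
      HypSpace.halfSphere 0 (1 / √(b : ℝ))) ∧
    O.IsClosedFor (HypSpace.halfSphere 0 (1 / √(b : ℝ))) ∧
    ∀ S : Set HypSpace, HypSpace.IsItgs S → S ≠ HypSpace.halfSphere 0 (1 / √(b : ℝ)) →
      ¬ O.IsClosedFor S := by
  have ha := hO.a_neg
  have hb := hO.b_pos
  have hb' : (0 : ℝ) < b := by exact_mod_cast hb
  refine ⟨Or.inl ⟨0, _, by positivity, rfl⟩, fun γ hγ => ?_,
    O.isClosedFor_halfSphere ha hb hO.division, fun S hS hne hc => ?_⟩
  · refine Set.Subset.antisymm ?_ fun x hx => ?_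
    · rintro _ ⟨x, hx, rfl⟩
      exact O.smul_mem_halfSphere ha hb hγ hx
    · exact ⟨γ⁻¹ • x, O.smul_mem_halfSphere ha hb (inv_mem hγ) hx, smul_inv_smul γ x⟩
  · obtain ⟨B, hB⟩ := QuatOrder.IsClosedFor.exists_height_le O ha hc
    exact hne (hS.eq_halfSphere_of_height_bounded hb hB)
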